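/- Let $\alpha\in[1,2]$ and $\psi(x)=\psi_\alpha(x)=\exp(|x|^\alpha)-1$. For a real random variable $X$ write $$\sigma_\psi=\|X\|_\psi=\inf\{\sigma>0 : \mathbb{E}\,\psi(|X|/\sigma)\le 1\}\in[0,\infty],$$ and for a sample $X_1,\dots,X_n$ write $$\widehat\sigma_\psi=\widehat\sigma_\psi(X_1,\dots,X_n)=\inf\Big\{\sigma>0 : \frac1n\sum_{i=1}^n\psi\Big(\frac{|X_i|}{\sigma}\Big)\le 1\Big\}.$$ Then for every $\beta>0$ there exists a real random variable $X$ with $\|X\|_\psi=1$ such that for every sequence $X_1,X_2,\dots$ of independent random variables, each with the same distribution as $X$, $$\limsup_{n\to\infty}\frac{|\widehat\sigma_\psi(X_1,\dots,X_n)-\sigma_\psi|}{n^{-\beta}}=\infty\qquad\text{almost surely}.$$ -/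

import Mathlib

open MeasureTheory ProbabilityTheory Filter
open scoped ENNReal

/-- The exponential-type Orlicz function `ψ_α(x) = exp(|x|^α) - 1`. -/
noncomputable def psiExp (α : ℝ) (x : ℝ) : ℝ :=
  Real.exp (|x| ^ α) - 1

/-- The Orlicz norm `‖X‖_ψ = inf {σ > 0 | E ψ(|X|/σ) ≤ 1}` of a real random variable, for a
nonnegative function `ψ`. The expectation is the `[0, ∞]`-valued one, and the norm is `∞` if no
`σ` is admissible. -/
noncomputable def orliczNorm {Ω : Type*} [MeasurableSpace Ω] (ψ : ℝ → ℝ) (X : Ω → ℝ)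
    (P : Measure Ω) : ℝ≥0∞ :=
  ⨅ (σ : ℝ) (_ : 0 < σ) (_ : ∫⁻ ω, ENNReal.ofReal (ψ (|X ω| / σ)) ∂P ≤ 1), ENNReal.ofReal σ

/-- The empirical Orlicz norm
`inf {σ > 0 | (1/n) ∑ i, ψ(|x i|/σ) ≤ 1}` of a finite sample. -/
noncomputable def empiricalOrliczNorm (ψ : ℝ → ℝ) {n : ℕ} (x : Fin n → ℝ) : ℝ :=
  sInf {σ : ℝ | 0 < σ ∧ (1 / (n : ℝ)) * ∑ i, ψ (|x i| / σ) ≤ 1}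

/-! The mean of `psiExp α X` can be carried by atoms too rare to be sampled. Let Y = `psiExp α X`
take the values 2^e_k, e_k = 5^(k+1), each contributing 2^-(k+1) to E Y = 1. Among n = 2^(4 e_k)
observations, atoms beyond the k-th almost never occur, as their total probability is at most 2^(-5
e_k). The truncated mean misses at least 2^-(k+2), and Chebyshev keeps the sample mean below 1 -
2^-(k+3).

Rescaling X by 1/σ raises 1 + Y to the power σ^(-α). As log(1 + Y) is of order at most e_k, a
deficit ε in the sample mean lowers the norm by order ε / e_k (`empiricalOrliczNorm_le_one_sub`).
Since e_k is logarithmic in n and 2^k ≤ e_k, this is at least of order 1 / (log n)^2, which beats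
every n^(-β). Borel-Cantelli gives it for all large k almost surely. -/

theorem one_add_psiExp (α x : ℝ) : 1 + psiExp α x = Real.exp (|x| ^ α) := by
  simp [psiExp]

theorem psiExp_nonneg (α x : ℝ) : 0 ≤ psiExp α x := by
  have : 0 ≤ |x| ^ α := by positivity
  simpa [psiExp] using this

theorem psiExp_abs_div (α x : ℝ) {σ : ℝ} (hσ : 0 < σ) :
    psiExp α (|x| / σ) = (1 + psiExp α x) ^ (σ ^ (-α)) - 1 := by
  rw [one_add_psiExp, ← Real.exp_mul, psiExp, abs_div, abs_abs, abs_of_pos hσ,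
    Real.div_rpow (abs_nonneg _) hσ.le, Real.rpow_neg hσ.le, div_eq_mul_inv]

theorem measurable_psiExp (α : ℝ) : Measurable (psiExp α) := by
  unfold psiExp
  fun_prop

/-- The nonnegative point at which `psiExp α` takes the value `y`. -/
noncomputable def psiExpInv (α y : ℝ) : ℝ := Real.log (1 + y) ^ α⁻¹

theorem psiExp_psiExpInv {α y : ℝ} (hα : 0 < α) (hy : 0 ≤ y) :
    psiExp α (psiExpInv α y) = y := by
  have hl : 0 ≤ Real.log (1 + y) := Real.log_nonneg (by linarith)
  rw [psiExp, psiExpInv, abs_of_nonneg (by positivity), ← Real.rpow_mul hl,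
    inv_mul_cancel₀ hα.ne', Real.rpow_one, Real.exp_log (by linarith)]
  ring

/-- For σ < 1 the exponent a = σ^(-α) exceeds 1, and Bernoulli's inequality (1 + y)^a - 1 ≥ a y
pushes the expectation up to at least a > 1. -/
theorem orliczNorm_psiExp_eq_one {Ω : Type*} [MeasurableSpace Ω] {α : ℝ} (hα : 0 < α)
    {X : Ω → ℝ} {P : Measure Ω} (h : ∫⁻ ω, ENNReal.ofReal (psiExp α (X ω)) ∂P = 1) :
    orliczNorm (psiExp α) X P = 1 := by
  apply le_antisymm
  · refine iInf_le_of_le 1 (iInf_le_of_le one_pos (iInf_le_of_le ?_ (by simp)))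
    simp only [psiExp_abs_div _ _ one_pos, Real.one_rpow, Real.rpow_one, add_sub_cancel_left, h,
      le_refl]
  · refine le_iInf fun σ => le_iInf fun hσ => le_iInf fun hle => ?_
    rw [ENNReal.one_le_ofReal]
    by_contra! hlt
    have ha : 1 < σ ^ (-α) := Real.one_lt_rpow_of_pos_of_lt_one_of_neg hσ hlt (by linarith)
    have hbound : ENNReal.ofReal (σ ^ (-α)) ≤ 1 := by
      calc ENNReal.ofReal (σ ^ (-α))
          = ∫⁻ ω, ENNReal.ofReal (σ ^ (-α)) * ENNReal.ofReal (psiExp α (X ω)) ∂P := by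
            rw [lintegral_const_mul' _ _ ENNReal.ofReal_ne_top, h, mul_one]
        _ ≤ ∫⁻ ω, ENNReal.ofReal (psiExp α (|X ω| / σ)) ∂P := by
            refine lintegral_mono fun ω => ?_
            rw [← ENNReal.ofReal_mul (by positivity)]
            refine ENNReal.ofReal_le_ofReal ?_
            rw [psiExp_abs_div _ _ hσ]
            have := one_add_mul_self_le_rpow_one_add
              (by linarith [psiExp_nonneg α (X ω)] : -1 ≤ psiExp α (X ω)) ha.le
            linarith
        _ ≤ 1 := hle
    rw [ENNReal.ofReal_le_one] at hbound
    linarith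

theorem empiricalOrliczNorm_le {ψ : ℝ → ℝ} {n : ℕ} {x : Fin n → ℝ} {σ : ℝ} (hσ : 0 < σ)
    (h : (1 / (n : ℝ)) * ∑ i, ψ (|x i| / σ) ≤ 1) : empiricalOrliczNorm ψ x ≤ σ :=
  csInf_le ⟨0, fun _ hs => hs.1.le⟩ ⟨hσ, h⟩

/-- If a sample is bounded and its mean `psiExp` is below one by `ε`, then its empirical norm is
below one by an amount proportional to `ε / m`, where `2 ^ m` bounds the values of `psiExp`. -/
theorem empiricalOrliczNorm_le_one_sub {α : ℝ} (hα : α ∈ Set.Icc (1 : ℝ) 2) {n : ℕ} (hn : 0 < n)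
    {x : Fin n → ℝ} {m : ℕ} (hm : 1 ≤ m) {ε δ : ℝ} (hδ : 0 < δ) (hδ4 : δ ≤ 1 / 4)
    (hεδ : 16 * δ * m ≤ ε) (hmax : ∀ i, psiExp α (x i) ≤ 2 ^ m)
    (hmean : ∑ i, psiExp α (x i) ≤ n * (1 - ε)) :
    empiricalOrliczNorm (psiExp α) x ≤ 1 - δ := by
  have hσ : 0 < 1 - δ := by linarith
  have hn' : (0 : ℝ) < n := by exact_mod_cast hn
  have hm' : (1 : ℝ) ≤ m := by exact_mod_cast hm
  apply empiricalOrliczNorm_le hσ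
  set a := (1 - δ) ^ (-α) with ha
  have ha1 : 1 ≤ a := Real.one_le_rpow_of_pos_of_le_one_of_nonpos hσ (by linarith)
    (by linarith [hα.1])
  -- Here α ≤ 2 and δ ≤ 1/4 enter: (1 + 4δ)(1 - δ)^2 ≥ 1.
  have ha2 : a ≤ 1 + 4 * δ := by
    calc a ≤ (1 - δ) ^ (-2 : ℝ) :=
          Real.rpow_le_rpow_of_exponent_ge hσ (by linarith) (by linarith [hα.2])
      _ = ((1 - δ) ^ 2)⁻¹ := by
          rw [Real.rpow_neg hσ.le]; norm_cast
      _ ≤ 1 + 4 * δ := by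
          rw [inv_le_iff_one_le_mul₀ (by positivity)]
          nlinarith [mul_nonneg hδ.le hδ.le, mul_nonneg hδ.le (sub_nonneg.2 hδ4),
            mul_nonneg (mul_nonneg hδ.le hδ.le) hδ.le]
  have hlog : Real.log (2 ^ (m + 1)) ≤ 2 * m := by
    rw [Real.log_pow]
    push_cast
    nlinarith [Real.log_two_lt_d9, Real.log_two_gt_d9]
  set η := ε / 2 with hη
  -- The extra power a - 1 ≤ 4δ costs at most exp(2m · 4δ), and 16δm ≤ ε bounds this by exp(ε/2).
  have hfactor : ∀ i, (1 + psiExp α (x i)) ^ a ≤ (1 + psiExp α (x i)) * Real.exp η := by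
    intro i
    have h1 : 1 ≤ 1 + psiExp α (x i) := by linarith [psiExp_nonneg α (x i)]
    have h0 : 0 < 1 + psiExp α (x i) := by linarith
    have h2 : 1 + psiExp α (x i) ≤ 2 ^ (m + 1) := by
      have : (1 : ℝ) ≤ 2 ^ m := one_le_pow₀ (by norm_num)
      rw [pow_succ]; linarith [hmax i]
    have h3 : Real.log (1 + psiExp α (x i)) ≤ 2 * m := (Real.log_le_log h0 h2).trans hlog
    have h4 : (1 + psiExp α (x i)) ^ (a - 1) ≤ Real.exp η := by
      rw [Real.rpow_def_of_pos h0]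
      refine Real.exp_le_exp.2 ?_
      calc Real.log (1 + psiExp α (x i)) * (a - 1) ≤ 2 * m * (4 * δ) :=
            mul_le_mul h3 (by linarith) (by linarith) (by positivity)
        _ ≤ η := by rw [hη]; linarith
    calc (1 + psiExp α (x i)) ^ a = (1 + psiExp α (x i)) * (1 + psiExp α (x i)) ^ (a - 1) := by
          rw [Real.rpow_sub_one h0.ne']; field_simp
      _ ≤ _ := mul_le_mul_of_nonneg_left h4 h0.le
  have hε1 : ε ≤ 1 := by
    have : 0 ≤ ∑ i, psiExp α (x i) := Finset.sum_nonneg fun i _ => psiExp_nonneg _ _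
    by_contra! h
    nlinarith
  have hexp : (2 - ε) * Real.exp η ≤ 2 := by
    have h1 : 1 - η ≤ Real.exp (-η) := by linarith [Real.add_one_le_exp (-η)]
    have h2 : Real.exp (-η) * Real.exp η = 1 := by rw [← Real.exp_add]; simp
    nlinarith [Real.exp_pos η]
  have hsum : ∑ i, psiExp α (|x i| / (1 - δ)) ≤ n := by
    calc ∑ i, psiExp α (|x i| / (1 - δ)) = ∑ i, ((1 + psiExp α (x i)) ^ a - 1) :=
          Finset.sum_congr rfl fun i _ => psiExp_abs_div _ _ hσ
      _ ≤ ∑ i, ((1 + psiExp α (x i)) * Real.exp η - 1) :=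
          Finset.sum_le_sum fun i _ => by linarith [hfactor i]
      _ = (n + ∑ i, psiExp α (x i)) * Real.exp η - n := by
          rw [Finset.sum_sub_distrib, ← Finset.sum_mul, Finset.sum_add_distrib]
          simp
      _ ≤ (n + n * (1 - ε)) * Real.exp η - n := by
          gcongr
      _ ≤ n := by nlinarith
  rw [one_div, inv_mul_le_iff₀ hn']
  simpa using hsum

/-- Chebyshev's inequality for the upper tail of a sum of bounded independent variables. -/
theorem measure_sum_ge_le_of_bounded {Ω : Type*} [MeasurableSpace Ω] {P : Measure Ω}
    [IsProbabilityMeasure P] {Z : ℕ → Ω → ℝ} (hind : iIndepFun Z P)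
    (hmeas : ∀ i, AEMeasurable (Z i) P) {b μ ε : ℝ} (hb : ∀ i ω, Z i ω ∈ Set.Icc 0 b)
    (hμ : ∀ i, ∫ ω, Z i ω ∂P ≤ μ) (hε : 0 < ε) {n : ℕ} (hn : 0 < n) :
    P {ω | n * (μ + ε) ≤ ∑ i ∈ Finset.range n, Z i ω} ≤ ENNReal.ofReal (b ^ 2 / (n * ε ^ 2)) := by
  have hn' : (0 : ℝ) < n := by exact_mod_cast hn
  have hL : ∀ i, MemLp (Z i) 2 P := fun i =>
    memLp_of_bounded (ae_of_all _ (hb i)) (hmeas i).aestronglyMeasurable 2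
  have hint : ∀ i, Integrable (Z i) P := fun i => (hL i).integrable (by norm_num)
  have hLs : MemLp (∑ i ∈ Finset.range n, Z i) 2 P := memLp_finsetSum' _ fun i _ => hL i
  have hE : P[∑ i ∈ Finset.range n, Z i] ≤ n * μ := by
    simp only [Finset.sum_apply]
    rw [integral_finsetSum _ fun i _ => hint i]
    calc _ ≤ ∑ i ∈ Finset.range n, μ := Finset.sum_le_sum fun i _ => hμ i
      _ = n * μ := by simp
  have hV : variance (∑ i ∈ Finset.range n, Z i) P ≤ n * b ^ 2 := by
    rw [IndepFun.variance_sum (fun i _ => hL i) fun i _ j _ hij => hind.indepFun hij]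
    calc _ ≤ ∑ i ∈ Finset.range n, b ^ 2 := Finset.sum_le_sum fun i _ => by
          have := variance_le_sq_of_bounded (ae_of_all P (hb i)) (hmeas i)
          nlinarith [sq_nonneg b]
      _ = n * b ^ 2 := by simp
  calc P {ω | n * (μ + ε) ≤ ∑ i ∈ Finset.range n, Z i ω}
      ≤ P {ω | n * ε ≤ |(∑ i ∈ Finset.range n, Z i) ω - P[∑ i ∈ Finset.range n, Z i]|} := by
        refine measure_mono fun ω hω => ?_
        simp only [Set.mem_ofPred_eq, Finset.sum_apply] at hω ⊢
        simp only [Finset.sum_apply] at hE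
        refine le_trans ?_ (le_abs_self _)
        linarith
    _ ≤ ENNReal.ofReal (variance (∑ i ∈ Finset.range n, Z i) P / (n * ε) ^ 2) :=
        meas_ge_le_variance_div_sq hLs (by positivity)
    _ ≤ _ := by
        refine ENNReal.ofReal_le_ofReal ?_
        calc _ ≤ n * b ^ 2 / (n * ε) ^ 2 := by gcongr
          _ = _ := by field_simp

/-! ### The spiked law -/

/-- Exponents of the atoms of the spiked law. -/
def spikeExponent (k : ℕ) : ℕ := 5 ^ (k + 1)

/-- Values of the spiked law: the atom `0`, then the atoms `2 ^ spikeExponent k`. -/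
noncomputable def spikeHeight : ℕ → ℝ
  | 0 => 0
  | k + 1 => 2 ^ spikeExponent k

/-- Masses of the nonzero atoms of the spiked law; atom `k` contributes `2⁻¹ ^ (k + 1)` to the
mean. -/
noncomputable def spikeWeight (k : ℕ) : ℝ≥0∞ := 2⁻¹ ^ (k + 1 + spikeExponent k)

/-- The probability measure on the indices of the atoms of the spiked law. -/
noncomputable def spikeMeasure : Measure ℕ :=
  (1 - ∑' k, spikeWeight k) • Measure.dirac 0 +
    Measure.sum fun k => spikeWeight k • Measure.dirac (k + 1)

theorem lintegral_spikeMeasure {f : ℕ → ℝ≥0∞} (hf : f 0 = 0) :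
    ∫⁻ j, f j ∂spikeMeasure = ∑' k, spikeWeight k * f (k + 1) := by
  simp [spikeMeasure, lintegral_add_measure, lintegral_sum_measure, hf]

theorem tsum_two_inv_pow_succ : ∑' k : ℕ, (2⁻¹ : ℝ≥0∞) ^ (k + 1) = 1 := by
  rw [ENNReal.tsum_geometric_add_one, ENNReal.one_sub_inv_two, inv_inv]
  exact ENNReal.inv_mul_cancel (by simp) (by simp)

instance isProbabilityMeasure_spikeMeasure : IsProbabilityMeasure spikeMeasure := by
  constructor
  -- Subtraction in `ℝ≥0∞` truncates, so the mass at 0 completes the total only under this bound.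
  have h : ∑' k, spikeWeight k ≤ 1 := by
    rw [← tsum_two_inv_pow_succ]
    refine ENNReal.tsum_le_tsum fun k => ?_
    exact pow_le_pow_of_le_one (by simp) (by simp [ENNReal.inv_le_one]) (by omega)
  simp [spikeMeasure, tsub_add_cancel_of_le h]

theorem spikeHeight_nonneg (j : ℕ) : 0 ≤ spikeHeight j := by
  cases j <;> simp [spikeHeight]

theorem spikeWeight_mul_spikeHeight (k : ℕ) :
    spikeWeight k * ENNReal.ofReal (spikeHeight (k + 1)) = 2⁻¹ ^ (k + 1) := by
  rw [spikeWeight, spikeHeight, ENNReal.ofReal_pow (by norm_num), pow_add, mul_assoc, ← mul_pow]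
  simp [ENNReal.inv_mul_cancel]

theorem lintegral_spikeHeight :
    ∫⁻ j, ENNReal.ofReal (spikeHeight j) ∂spikeMeasure = 1 := by
  rw [lintegral_spikeMeasure (by simp [spikeHeight])]
  simp_rw [spikeWeight_mul_spikeHeight, tsum_two_inv_pow_succ]

theorem spikeExponent_strictMono : StrictMono spikeExponent := fun _ _ h =>
  Nat.pow_lt_pow_right (by norm_num) (by omega)

theorem spikeHeight_le_or (k j : ℕ) :
    spikeHeight j ≤ 2 ^ spikeExponent k ∨ 2 ^ spikeExponent (k + 1) ≤ spikeHeight j := by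
  cases j with
  | zero => left; simp [spikeHeight]
  | succ j =>
    rcases le_or_gt j k with h | h
    · left
      exact pow_le_pow_right₀ (by norm_num) (spikeExponent_strictMono.monotone h)
    · right
      exact pow_le_pow_right₀ (by norm_num) (spikeExponent_strictMono.monotone h)

/-- Markov's inequality with mean 1, applied at the next height because there are no atoms in
between. -/
theorem spikeMeasure_lt_spikeHeight_le (k : ℕ) :
    spikeMeasure {j | 2 ^ spikeExponent k < spikeHeight j} ≤ 2⁻¹ ^ spikeExponent (k + 1) := by
  calc spikeMeasure {j | 2 ^ spikeExponent k < spikeHeight j}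
      ≤ spikeMeasure {j | 2 ^ spikeExponent (k + 1) ≤ ENNReal.ofReal (spikeHeight j)} := by
        refine measure_mono fun j hj => ?_
        have h := (spikeHeight_le_or k j).resolve_left (not_le.2 hj)
        simpa [ENNReal.ofReal_pow] using ENNReal.ofReal_le_ofReal h
    _ ≤ (∫⁻ j, ENNReal.ofReal (spikeHeight j) ∂spikeMeasure) / 2 ^ spikeExponent (k + 1) :=
        meas_ge_le_lintegral_div (measurable_of_countable _).aemeasurable (by simp) (by simp)
    _ = _ := by rw [lintegral_spikeHeight, one_div, ENNReal.inv_pow]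

/-- Truncation of a function at height `b`, larger values being replaced by `0`. -/
noncomputable def cutAbove (b y : ℝ) : ℝ := if y ≤ b then y else 0

theorem measurable_cutAbove (b : ℝ) : Measurable (cutAbove b) :=
  Measurable.ite measurableSet_Iic measurable_id measurable_const

theorem cutAbove_mem_Icc {b y : ℝ} (hb : 0 ≤ b) (hy : 0 ≤ y) : cutAbove b y ∈ Set.Icc 0 b := by
  unfold cutAbove
  split_ifs with h
  · exact ⟨hy, h⟩
  · exact ⟨le_rfl, hb⟩

theorem integral_cutAbove_spikeHeight_le (k : ℕ) :
    ∫ j, cutAbove (2 ^ spikeExponent k) (spikeHeight j) ∂spikeMeasure ≤ 1 - 2⁻¹ ^ (k + 2) := by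
  have hnn : ∀ j, 0 ≤ cutAbove (2 ^ spikeExponent k) (spikeHeight j) := fun j =>
    (cutAbove_mem_Icc (by positivity) (spikeHeight_nonneg j)).1
  rw [integral_eq_lintegral_of_nonneg_ae (ae_of_all _ hnn)
    (measurable_of_countable _).aestronglyMeasurable]
  -- The loss of atom k + 1 alone suffices: its contribution 2^-(k+2) is put back at that index and
  -- the series are compared termwise.
  have h : ∫⁻ j, ENNReal.ofReal (cutAbove (2 ^ spikeExponent k) (spikeHeight j)) ∂spikeMeasure
      + 2⁻¹ ^ (k + 2) ≤ 1 := by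
    rw [lintegral_spikeMeasure (by simp [spikeHeight, cutAbove]),
      ← tsum_ite_eq (k + 1) (fun _ => (2⁻¹ : ℝ≥0∞) ^ (k + 2)), ← ENNReal.tsum_add,
      ← tsum_two_inv_pow_succ]
    refine ENNReal.tsum_le_tsum fun j => ?_
    split_ifs with hj
    · subst hj
      have : ¬ spikeHeight (k + 1 + 1) ≤ 2 ^ spikeExponent k := not_le.2 <|
        pow_lt_pow_right₀ (by norm_num) (spikeExponent_strictMono (Nat.lt_succ_self k))
      simp [cutAbove, this]
    · rw [add_zero, ← spikeWeight_mul_spikeHeight]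
      gcongr
      unfold cutAbove
      split_ifs
      · exact le_rfl
      · exact spikeHeight_nonneg _
  have hne : ∫⁻ j, ENNReal.ofReal (cutAbove (2 ^ spikeExponent k) (spikeHeight j)) ∂spikeMeasure
      ≠ ∞ := ne_top_of_le_ne_top ENNReal.one_ne_top (le_self_add.trans h)
  have h' := ENNReal.toReal_mono ENNReal.one_ne_top h
  rw [ENNReal.toReal_add hne (by simp)] at h'
  simp only [ENNReal.toReal_pow, ENNReal.toReal_inv, ENNReal.toReal_ofNat,
    ENNReal.toReal_one] at h'
  linarith

/-- A variable whose `psiExp` follows the spiked law. -/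
noncomputable def spikeVar (α : ℝ) (j : ℕ) : ℝ := psiExpInv α (spikeHeight j)

theorem psiExp_spikeVar {α : ℝ} (hα : 0 < α) (j : ℕ) :
    psiExp α (spikeVar α j) = spikeHeight j :=
  psiExp_psiExpInv hα (spikeHeight_nonneg j)

theorem orliczNorm_spikeVar {α : ℝ} (hα : 0 < α) :
    orliczNorm (psiExp α) (spikeVar α) spikeMeasure = 1 :=
  orliczNorm_psiExp_eq_one hα (by simp_rw [psiExp_spikeVar hα, lintegral_spikeHeight])

/-! ### Sample sizes and rate -/

/-- The sample sizes at which the empirical norm of the spiked law is small. -/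
def spikeSize (k : ℕ) : ℕ := 2 ^ (4 * spikeExponent k)

/-- A lower bound for the deviation of the empirical norm at sample size `spikeSize k`. -/
noncomputable def spikeGap (k : ℕ) : ℝ := 2⁻¹ ^ (k + 7) / spikeExponent k

theorem lt_spikeExponent (k : ℕ) : k + 1 < spikeExponent k :=
  Nat.lt_pow_self (by norm_num)

theorem tendsto_spikeExponent : Tendsto spikeExponent atTop atTop :=
  spikeExponent_strictMono.tendsto_atTop

theorem tendsto_spikeSize : Tendsto spikeSize atTop atTop := by
  refine tendsto_atTop_mono (fun k => ?_) tendsto_spikeExponent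
  exact (Nat.lt_two_pow_self.le.trans (Nat.pow_le_pow_right (by norm_num) (by omega)))

theorem tendsto_spikeGap_div {β : ℝ} (hβ : 0 < β) :
    Tendsto (fun k => spikeGap k / (spikeSize k : ℝ) ^ (-β)) atTop atTop := by
  have hc : 0 < 4 * β * Real.log 2 := by positivity
  have h1 : Tendsto (fun x : ℝ => Real.exp (4 * β * Real.log 2 * x) / x ^ (2 : ℝ)) atTop atTop :=
    tendsto_exp_mul_div_rpow_atTop 2 _ hc
  have h2 := (h1.comp (tendsto_natCast_atTop_atTop.comp tendsto_spikeExponent)).atTop_mul_const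
    (by norm_num : (0 : ℝ) < 2⁻¹ ^ 7)
  refine tendsto_atTop_mono (fun k => ?_) h2
  have he : (0 : ℝ) < spikeExponent k := by exact_mod_cast (Nat.succ_pos k).trans (lt_spikeExponent k)
  have hpow : ((spikeSize k : ℝ) ^ (-β))⁻¹ = Real.exp (4 * β * Real.log 2 * spikeExponent k) := by
    rw [Real.rpow_neg (by positivity), inv_inv, spikeSize, Real.rpow_def_of_pos (by positivity)]
    push_cast
    rw [Real.log_pow]
    congr 1
    push_cast
    ring
  -- This makes the gap at least 2^-7 / e_k^2, while `spikeSize k` to the power β is exponential in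
  -- e_k.
  have hk : (2 : ℝ) ^ k ≤ spikeExponent k := by
    have : 2 ^ k ≤ spikeExponent k :=
      (Nat.pow_le_pow_left (by norm_num) k).trans (Nat.pow_le_pow_right (by norm_num) (by omega))
    exact_mod_cast this
  rw [div_eq_mul_inv (spikeGap k), hpow, mul_comm (spikeGap k)]
  simp only [Function.comp_apply]
  rw [div_mul_eq_mul_div, mul_div_assoc]
  refine mul_le_mul_of_nonneg_left ?_ (Real.exp_pos _).le
  calc (2⁻¹ : ℝ) ^ 7 / (spikeExponent k : ℝ) ^ (2 : ℝ)
      = (spikeExponent k : ℝ)⁻¹ * (2⁻¹ ^ 7 / spikeExponent k) := by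
        rw [Real.rpow_two, div_eq_mul_inv, div_eq_mul_inv, sq, mul_inv]
        ring
    _ ≤ (2⁻¹ : ℝ) ^ k * (2⁻¹ ^ 7 / spikeExponent k) := by
        rw [inv_pow (2 : ℝ) k]
        gcongr
    _ = spikeGap k := by
        rw [spikeGap, pow_add, mul_div_assoc]

/-! ### Almost sure behaviour of the sample -/

section Sample

variable {Ω : Type*} [MeasurableSpace Ω] {P : Measure Ω} {Xs : ℕ → Ω → ℝ} {α : ℝ}

theorem measure_exists_lt_psiExp_le (hα : 0 < α)
    (hid : ∀ i, IdentDistrib (Xs i) (spikeVar α) P spikeMeasure) (k : ℕ) :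
    P {ω | ∃ i < spikeSize k, 2 ^ spikeExponent k < psiExp α (Xs i ω)} ≤ 2⁻¹ ^ k := by
  have hi : ∀ i, P {ω | 2 ^ spikeExponent k < psiExp α (Xs i ω)} ≤
      2⁻¹ ^ spikeExponent (k + 1) := fun i => by
    have h := (hid i).measure_mem_eq (s := {x | 2 ^ spikeExponent k < psiExp α x})
      (measurableSet_lt measurable_const (measurable_psiExp α))
    simp only [Set.preimage_ofPred_eq, psiExp_spikeVar hα] at h
    exact h.trans_le (spikeMeasure_lt_spikeHeight_le k)
  calc P {ω | ∃ i < spikeSize k, 2 ^ spikeExponent k < psiExp α (Xs i ω)}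
      = P (⋃ i ∈ Finset.range (spikeSize k), {ω | 2 ^ spikeExponent k < psiExp α (Xs i ω)}) := by
        congr 1; ext ω; simp
    _ ≤ ∑ i ∈ Finset.range (spikeSize k), P {ω | 2 ^ spikeExponent k < psiExp α (Xs i ω)} :=
        measure_biUnion_finset_le _ _
    _ ≤ ∑ i ∈ Finset.range (spikeSize k), (2⁻¹ : ℝ≥0∞) ^ spikeExponent (k + 1) :=
        Finset.sum_le_sum fun i _ => hi i
    _ = 2⁻¹ ^ spikeExponent k := by
        -- The base 5 is chosen for this: 4 e_k pays for the union bound over the sample and e_k is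
        -- left over.
        have he : spikeExponent (k + 1) = 4 * spikeExponent k + spikeExponent k := by
          simp [spikeExponent]; ring
        rw [Finset.sum_const, Finset.card_range, nsmul_eq_mul, he, pow_add, ← mul_assoc, spikeSize]
        push_cast
        rw [← mul_pow, ENNReal.mul_inv_cancel (by simp) (by simp), one_pow, one_mul]
    _ ≤ 2⁻¹ ^ k := pow_le_pow_of_le_one (by simp) (by simp [ENNReal.inv_le_one])
        (by have := lt_spikeExponent k; omega)

theorem measure_sum_cutAbove_ge_le [IsProbabilityMeasure P] (hα : 0 < α) (hind : iIndepFun Xs P)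
    (hid : ∀ i, IdentDistrib (Xs i) (spikeVar α) P spikeMeasure) (k : ℕ) :
    P {ω | (spikeSize k : ℝ) * (1 - 2⁻¹ ^ (k + 3)) ≤ ∑ i ∈ Finset.range (spikeSize k),
      cutAbove (2 ^ spikeExponent k) (psiExp α (Xs i ω))} ≤ 2⁻¹ ^ k := by
  set g : ℝ → ℝ := fun x => cutAbove (2 ^ spikeExponent k) (psiExp α x) with hg
  have hgm : Measurable g := (measurable_cutAbove _).comp (measurable_psiExp α)
  have hmean : ∀ i, ∫ ω, (g ∘ Xs i) ω ∂P ≤ 1 - 2⁻¹ ^ (k + 2) := fun i => by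
    rw [((hid i).comp hgm).integral_eq]
    simp only [Function.comp_apply, hg, psiExp_spikeVar hα]
    exact integral_cutAbove_spikeHeight_le k
  have h := measure_sum_ge_le_of_bounded (hind.comp (fun _ => g) fun _ => hgm)
    (fun i => hgm.comp_aemeasurable (hid i).aemeasurable_fst)
    (b := 2 ^ spikeExponent k) (μ := 1 - 2⁻¹ ^ (k + 2)) (ε := 2⁻¹ ^ (k + 3))
    (fun i ω => cutAbove_mem_Icc (by positivity) (psiExp_nonneg _ _)) hmean (by positivity)
    (n := spikeSize k) (by unfold spikeSize; positivity)
  have he : (1 : ℝ) - 2⁻¹ ^ (k + 2) + 2⁻¹ ^ (k + 3) = 1 - 2⁻¹ ^ (k + 3) := by ring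
  rw [he] at h
  refine h.trans ?_
  rw [← ENNReal.ofReal_ofNat 2, ← ENNReal.ofReal_inv_of_pos (by norm_num),
    ← ENNReal.ofReal_pow (by norm_num)]
  refine ENNReal.ofReal_le_ofReal ?_
  -- Of the exponent 3k + 6, the part 2(k + 3) comes from ε^-2 in Chebyshev and k from the target
  -- 2^-k.
  have hE : 3 * k + 6 ≤ 2 * spikeExponent k := by
    have h2 : k + 1 ≤ 5 ^ k := Nat.lt_pow_self (by norm_num)
    simp only [spikeExponent, pow_succ]
    omega
  rw [div_le_iff₀ (by unfold spikeSize; positivity), spikeSize]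
  calc ((2 : ℝ) ^ spikeExponent k) ^ 2 = 2 ^ (2 * spikeExponent k) := by rw [← pow_mul, mul_comm]
    _ = 2⁻¹ ^ (3 * k + 6) * (2 ^ (3 * k + 6) * 2 ^ (2 * spikeExponent k)) := by
        rw [← mul_assoc, ← mul_pow]; norm_num
    _ ≤ 2⁻¹ ^ (3 * k + 6) * (2 ^ (2 * spikeExponent k) * 2 ^ (2 * spikeExponent k)) := by
        gcongr
        norm_num
    _ = _ := by
        push_cast
        ring

/-- Both bad events have summable probabilities; outside them truncation changes no observation, so
the bound on the truncated sum is one on the sample mean. -/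
theorem ae_eventually_empiricalOrliczNorm_le [IsProbabilityMeasure P] (hα : α ∈ Set.Icc (1 : ℝ) 2) (hind : iIndepFun Xs P)
    (hid : ∀ i, IdentDistrib (Xs i) (spikeVar α) P spikeMeasure) :
    ∀ᵐ ω ∂P, ∀ᶠ k in atTop,
      empiricalOrliczNorm (psiExp α) (fun i : Fin (spikeSize k) => Xs i ω) ≤ 1 - spikeGap k := by
  have hα0 : 0 < α := by linarith [hα.1]
  have hsum : ∑' k : ℕ, (2⁻¹ : ℝ≥0∞) ^ k ≠ ∞ := by
    rw [ENNReal.tsum_geometric, ENNReal.one_sub_inv_two]; simp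
  have h1 := ae_eventually_notMem (ne_top_of_le_ne_top hsum
    (ENNReal.tsum_le_tsum fun k => measure_exists_lt_psiExp_le hα0 hid k))
  have h2 := ae_eventually_notMem (ne_top_of_le_ne_top hsum
    (ENNReal.tsum_le_tsum fun k => measure_sum_cutAbove_ge_le hα0 hind hid k))
  filter_upwards [h1, h2] with ω hω1 hω2
  filter_upwards [hω1, hω2] with k hk1 hk2
  simp only [not_exists, not_and, not_lt, not_le] at hk1 hk2
  have hE : (1 : ℝ) ≤ spikeExponent k := by
    exact_mod_cast (Nat.succ_pos k).trans (lt_spikeExponent k)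
  refine empiricalOrliczNorm_le_one_sub hα (by unfold spikeSize; positivity)
    (m := spikeExponent k) (by exact_mod_cast hE) (ε := 2⁻¹ ^ (k + 3))
    (by unfold spikeGap; positivity) ?_ ?_ (fun i => hk1 i i.2) ?_
  · calc spikeGap k ≤ 2⁻¹ ^ (k + 7) := div_le_self (by positivity) hE
      _ ≤ 2⁻¹ ^ 2 := pow_le_pow_of_le_one (by norm_num) (by norm_num) (by omega)
      _ = 1 / 4 := by norm_num
  · rw [spikeGap, mul_assoc, div_mul_cancel₀ _ (by positivity)]
    exact le_of_eq (by ring)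
  · rw [Fin.sum_univ_eq_sum_range fun i => psiExp α (Xs i ω)]
    refine le_trans (le_of_eq ?_) hk2.le
    refine Finset.sum_congr rfl fun i hi => ?_
    rw [cutAbove, if_pos (hk1 i (Finset.mem_range.1 hi))]

end Sample

theorem theorem5 (α : ℝ) (hα : α ∈ Set.Icc (1 : ℝ) 2) (β : ℝ) (hβ : 0 < β) :
    ∃ (Ω₀ : Type) (_ : MeasurableSpace Ω₀) (P₀ : Measure Ω₀) (_ : IsProbabilityMeasure P₀)
      (X : Ω₀ → ℝ),
      Measurable X ∧ orliczNorm (psiExp α) X P₀ = 1 ∧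
      ∀ (Ω : Type*) (_ : MeasurableSpace Ω) (P : Measure Ω) (_ : IsProbabilityMeasure P)
        (Xs : ℕ → Ω → ℝ),
        iIndepFun Xs P → (∀ i, IdentDistrib (Xs i) X P P₀) →
        ∀ᵐ ω ∂P,
          limsup (fun n : ℕ =>
            ((|empiricalOrliczNorm (psiExp α) (fun i : Fin n => Xs i ω)
                - (orliczNorm (psiExp α) X P₀).toReal| / (n : ℝ) ^ (-β) : ℝ) : EReal))
            atTop = ⊤ := by
  have hα0 : 0 < α := by linarith [hα.1]
  refine ⟨ℕ, inferInstance, spikeMeasure, inferInstance, spikeVar α, measurable_of_countable _,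
    orliczNorm_spikeVar hα0, ?_⟩
  intro Ω _ P _ Xs hind hid
  filter_upwards [ae_eventually_empiricalOrliczNorm_le hα hind hid] with ω hω
  rw [orliczNorm_spikeVar hα0, ENNReal.toReal_one]
  refine (EReal.eq_top_iff_forall_lt _).2 fun M => ?_
  refine lt_of_lt_of_le (EReal.coe_lt_coe_iff.2 (lt_add_one M)) ?_
  -- The sizes `spikeSize k` tend to infinity, so a lower bound along them bounds the limsup.
  refine le_limsup_of_frequently_le (tendsto_spikeSize.frequently (Eventually.frequently ?_))
  filter_upwards [hω, (tendsto_spikeGap_div hβ).eventually_ge_atTop (M + 1)] with k hk hM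
  refine EReal.coe_le_coe_iff.2 (hM.trans ?_)
  gcongr
  rw [abs_sub_comm]
  exact le_trans (by linarith) (le_abs_self _)
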